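/- Let $n\ge 0$ be an integer and $p$ a prime. Let $M,\tilde M\in M_n(\mathbb Z)$ be expanding (all complex eigenvalues have modulus $>1$), and let $D,\tilde D\subset\mathbb Z^n$ be nonempty finite sets. Let $\mu_{M,D}$ denote the self-affine measure of $(M,D)$, i.e. the unique Borel probability measure $\mu$ on $\mathbb R^n$ with $$\mu=\frac1{|D|}\sum_{d\in D}\mu\circ\phi_d^{-1},\qquad \phi_d(x)=M^{-1}(x+d),$$ and define $\mu_{\tilde M,\tilde D}$ likewise. Suppose that $(M,D)$ and $(\tilde M,\tilde D)$ are conjugate in $GL_n(p)$: there are integer matrices $A,B\in M_n(\mathbb Z)$, invertible modulo $p$, with $AB\equiv I\pmod p$, $\tilde M=AMB$, and $D=B\tilde D$ or $\tilde D=AD$. For a nonempty finite $D\subset\mathbb Z^n$ put $$m_D(x)=\frac1{|D|}\sum_{d\in D}e^{2\pi i\langle d,x\rangle},\qquad \mathcal Z_D^n=\{x\in[0,1)^n: m_D(x)=0\},$$ and let $\mathring E_p^n=\{\tfrac1p(l_1,\dots,l_n)^t: l_i\in\mathbb Z,\ 0\le l_i\le p-1\}\setminus\{0\}$. Suppose that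 $\mathcal Z_{\tilde D}^n\subset\mathring E_p^n$ or $\mathcal Z_D^n\subset\mathring E_p^n$. For $\Lambda\subset\mathbb R^n$ say that $E(\Lambda)=\{e^{2\pi i\langle\lambda,x\rangle}:\lambda\in\Lambda\}$ is an orthogonal set of exponentials in $L^2(\mu)$ if the exponentials with frequencies $\lambda\ne\lambda'$ in $\Lambda$ are orthogonal in $L^2(\mu)$. Let $n^*(\mu)$ be the supremum of $|\Lambda|$ over all finite or countable $\Lambda$ such that $E(\Lambda)$ is a maximal orthogonal set of exponentials in $L^2(\mu)$ (no proper superset of $\Lambda$ gives an orthogonal set). Then there is an infinite $\Lambda$ such that $E(\Lambda)$ is orthogonal in $L^2(\mu_{M,D})$ if and only if there is an infinite $\tilde\Lambda$ such that $E(\tilde\Lambda)$ is orthogonal in $L^2(\mu_{\tilde M,\tilde D})$. Moreover, if $\det M\notin p\mathbb Z$, then $$n^*(\mu_{M,D})=n^*(\mu_{\tilde M,\tilde D})\le p^n.$$ -/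

import Mathlib

open MeasureTheory
open scoped ENNReal

namespace SelfAffine

lemma exists_norm_pow_le {A : Type*} [NormedRing A] [NormedAlgebra ℂ A] [CompleteSpace A]
    [Nontrivial A] (a : A) (ha : ∀ z ∈ spectrum ℂ a, ‖z‖ < 1) :
    ∃ r : ℝ, 0 ≤ r ∧ r < 1 ∧ ∀ᶠ k : ℕ in Filter.atTop, ‖a ^ k‖ ≤ r ^ k := by
  have hrad : spectralRadius ℂ a < (1 : NNReal) := by
    apply spectrum.spectralRadius_lt_of_forall_lt
    intro z hz
    exact_mod_cast ha z hz
  have hG := spectrum.pow_nnnorm_pow_one_div_tendsto_nhds_spectralRadius a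
  obtain ⟨r, hr1, hr2⟩ := ENNReal.lt_iff_exists_nnreal_btwn.1 hrad
  have hr2' : (r : ℝ) < 1 := by exact_mod_cast hr2
  refine ⟨r, r.2, hr2', ?_⟩
  filter_upwards [hG.eventually_lt_const hr1, Filter.eventually_gt_atTop 0] with k hk hk0
  have h1 : (‖a ^ k‖₊ : ℝ≥0∞) ≤ (r : ℝ≥0∞) ^ k := by
    have hk' : (0 : ℝ) < 1 / k := by positivity
    rw [← ENNReal.rpow_le_rpow_iff hk']
    refine hk.le.trans (le_of_eq ?_)
    rw [← ENNReal.rpow_natCast, ← ENNReal.rpow_mul, mul_one_div_cancel (by positivity),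
      ENNReal.rpow_one]
  exact_mod_cast h1

section
attribute [local instance] Matrix.linftyOpNormedRing Matrix.linftyOpNormedAlgebra

lemma exists_entry_pow_le {n : ℕ} (N : Matrix (Fin n) (Fin n) ℂ)
    (hN : ∀ z ∈ spectrum ℂ N, ‖z‖ < 1) :
    ∃ r : ℝ, 0 ≤ r ∧ r < 1 ∧
      ∀ᶠ k : ℕ in Filter.atTop, ∀ i j, ‖(N ^ k) i j‖ ≤ r ^ k := by
  rcases Nat.eq_zero_or_pos n with rfl | hn
  · exact ⟨0, le_rfl, zero_lt_one, Filter.Eventually.of_forall fun k i => i.elim0⟩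
  have : Nonempty (Fin n) := ⟨⟨0, hn⟩⟩
  obtain ⟨r, h0, h1, h⟩ := exists_norm_pow_le N hN
  refine ⟨r, h0, h1, h.mono fun k hk i j => le_trans ?_ hk⟩
  generalize N ^ k = Q
  have h2 := Matrix.linfty_opNNNorm_def Q
  have h3 : ‖Q i j‖₊ ≤ ‖Q‖₊ := by
    rw [h2]
    exact (Finset.single_le_sum (f := fun j => ‖Q i j‖₊) (fun _ _ => zero_le)
      (Finset.mem_univ j)).trans
      (Finset.le_sup (f := fun i => ∑ j, ‖Q i j‖₊) (Finset.mem_univ i))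
  exact_mod_cast h3
end

variable {n : ℕ}

/-- An integer matrix is expanding if all its (complex) eigenvalues have modulus `> 1`. -/
def IsExpanding (M : Matrix (Fin n) (Fin n) ℤ) : Prop :=
  ∀ z ∈ spectrum ℂ (M.map (fun a : ℤ => (a : ℂ))), 1 < ‖z‖

/-- An integer vector, seen in `ℝⁿ`. -/
def toReal (d : Fin n → ℤ) : Fin n → ℝ := fun i => (d i : ℝ)

/-- The real inverse matrix `M⁻¹`. -/
noncomputable def realInv (M : Matrix (Fin n) (Fin n) ℤ) : Matrix (Fin n) (Fin n) ℝ :=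
  (M.map (fun a : ℤ => (a : ℝ)))⁻¹

/-- `φ_d(x) = M⁻¹ (x + d)`. -/
noncomputable def ifsMap (M : Matrix (Fin n) (Fin n) ℤ) (d : Fin n → ℤ) (x : Fin n → ℝ) :
    Fin n → ℝ :=
  (realInv M).mulVec (x + toReal d)

/-- `μ` is a Borel probability measure on `ℝⁿ` with `μ = |D|⁻¹ ∑_{d ∈ D} μ ∘ φ_d⁻¹`. -/
structure IsSelfAffineMeasure (M : Matrix (Fin n) (Fin n) ℤ) (D : Finset (Fin n → ℤ))
    (μ : Measure (Fin n → ℝ)) : Prop where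
  isProbabilityMeasure : IsProbabilityMeasure μ
  eq_average : μ = (D.card : ℝ≥0∞)⁻¹ • ∑ d ∈ D, μ.map (ifsMap M d)

lemma summable_entry {M : Matrix (Fin n) (Fin n) ℤ} (hM : IsExpanding M) (i j : Fin n) :
    Summable fun k : ℕ => |(realInv M ^ k) i j| := by
  set MC := M.map (fun a : ℤ => (a : ℂ)) with hMC
  set MR := M.map (fun a : ℤ => (a : ℝ)) with hMR
  have h0 : (0 : ℂ) ∉ spectrum ℂ MC := fun h => by
    have := hM 0 h
    norm_num at this
  have hu : IsUnit MC := spectrum.zero_notMem_iff ℂ |>.1 h0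
  have hmapMR : MC = MR.map Complex.ofRealHom := by
    ext a b; simp [hMC, hMR]
  have hdet : MC.det = (MR.det : ℂ) := by
    rw [hmapMR]; exact (RingHom.map_det Complex.ofRealHom MR).symm
  have huR : IsUnit MR.det := by
    have := (Matrix.isUnit_iff_isUnit_det _).1 hu
    rw [hdet] at this
    simpa using this
  have hmap : MC⁻¹ = (realInv M).map Complex.ofRealHom := by
    apply Matrix.inv_eq_right_inv
    rw [hmapMR, ← Matrix.map_mul, realInv, Matrix.mul_nonsing_inv _ huR]
    exact Matrix.map_one _ (map_zero _) (map_one _)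
  obtain ⟨u, hu⟩ := hu
  have hinv : MC⁻¹ = ((u⁻¹ : (Matrix (Fin n) (Fin n) ℂ)ˣ) : Matrix (Fin n) (Fin n) ℂ) := by
    rw [← hu, Matrix.coe_units_inv]
  obtain ⟨r, hr0, hr1, hr⟩ := exists_entry_pow_le MC⁻¹ (by
    intro z hz
    rw [hinv, ← spectrum.inv₀_mem_iff, hu] at hz
    have h1 := hM _ hz
    rw [norm_inv] at h1
    by_contra hcon
    exact absurd h1 (not_lt.2 (inv_le_one_of_one_le₀ (not_lt.1 hcon))))
  have hpow : ∀ k : ℕ, (((realInv M ^ k) i j : ℝ) : ℂ) = (MC⁻¹ ^ k) i j := by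
    intro k
    have : (realInv M ^ k).map (Complex.ofRealHom) = MC⁻¹ ^ k := by
      rw [hmap]; exact Matrix.map_pow _ Complex.ofRealHom k
    rw [← this]; rfl
  have hev2 : ∀ᶠ k : ℕ in Filter.atTop, ‖(realInv M ^ k) i j‖ ≤ r ^ k := by
    filter_upwards [hr] with k hk
    have := hk i j
    rwa [← hpow, Complex.norm_real] at this
  have hs : Summable fun k : ℕ => (realInv M ^ k) i j :=
    summable_of_isBigO_nat (summable_geometric_of_lt_one hr0 hr1)
      (Asymptotics.IsBigO.of_bound 1 (hev2.mono fun k hk => by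
        rw [one_mul, Real.norm_eq_abs (r ^ k), abs_of_nonneg (pow_nonneg hr0 k)]
        exact hk))
  simpa using hs.norm


lemma tendsto_pow_mulVec {M : Matrix (Fin n) (Fin n) ℤ} (hM : IsExpanding M) (v : Fin n → ℝ) :
    Filter.Tendsto (fun k : ℕ => (realInv M ^ k).mulVec v) Filter.atTop (nhds 0) := by
  rw [tendsto_pi_nhds]
  intro i
  have : Filter.Tendsto (fun k : ℕ => ∑ j, (realInv M ^ k) i j * v j) Filter.atTop
      (nhds (∑ j, 0 * v j)) :=
    tendsto_finsetSum _ fun j _ =>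
      ((summable_entry hM i j).of_abs.tendsto_atTop_zero).mul_const _
  simpa [Matrix.mulVec, dotProduct] using this

lemma continuous_ifsMap (M : Matrix (Fin n) (Fin n) ℤ) (d : Fin n → ℤ) :
    Continuous (ifsMap M d) := by
  unfold ifsMap
  fun_prop

lemma charFun_selfAffine {M : Matrix (Fin n) (Fin n) ℤ} {D : Finset (Fin n → ℤ)}
    {μ : Measure (Fin n → ℝ)} (h : IsSelfAffineMeasure M D μ)
    (L : StrongDual ℝ (Fin n → ℝ)) :
    charFunDual μ L = (D.card : ℂ)⁻¹ * ∑ d ∈ D,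
      (Complex.exp (L ((realInv M).mulVec (toReal d)) * Complex.I) *
        charFunDual μ (L ∘L (Matrix.mulVecLin (realInv M)).toContinuousLinearMap)) := by
  have := h.isProbabilityMeasure
  have key : ∀ d ∈ D, Integrable (fun v => Complex.exp (L v * Complex.I))
      (μ.map (ifsMap M d)) := by
    intro d _
    have := Measure.isProbabilityMeasure_map (μ := μ) (continuous_ifsMap M d).aemeasurable
    refine Integrable.of_bound (C := 1) (by fun_prop) (Filter.Eventually.of_forall fun v => ?_)
    rw [Complex.norm_exp_ofReal_mul_I]
  rw [charFunDual_apply]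
  conv_lhs => rw [h.eq_average]
  rw [integral_smul_measure, integral_finsetSum_measure key]
  simp only [ENNReal.toReal_inv, ENNReal.toReal_natCast, Complex.real_smul, Complex.ofReal_inv,
    Complex.ofReal_natCast]
  congr 1
  refine Finset.sum_congr rfl fun d _ => ?_
  rw [integral_map (continuous_ifsMap M d).aemeasurable (by fun_prop), charFunDual_apply,
    ← integral_const_mul]
  congr 1
  ext v
  rw [← Complex.exp_add]
  congr 1
  simp [ifsMap, Matrix.mulVec_add]
  ring

lemma unique_selfAffine {M : Matrix (Fin n) (Fin n) ℤ} (hM : IsExpanding M)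
    {D : Finset (Fin n → ℤ)} {μ ν : Measure (Fin n → ℝ)}
    (hμ : IsSelfAffineMeasure M D μ) (hν : IsSelfAffineMeasure M D ν) : μ = ν := by
  have := hμ.isProbabilityMeasure
  have := hν.isProbabilityMeasure
  refine Measure.ext_of_charFunDual (funext fun L => ?_)
  set T := (Matrix.mulVecLin (realInv M)).toContinuousLinearMap with hT
  have step : ∀ L : StrongDual ℝ (Fin n → ℝ), ‖charFunDual μ L - charFunDual ν L‖ ≤
      ‖charFunDual μ (L ∘L T) - charFunDual ν (L ∘L T)‖ := by
    intro L
    rw [charFun_selfAffine hμ, charFun_selfAffine hν, ← Finset.sum_mul, ← Finset.sum_mul,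
      ← hT, ← mul_assoc, ← mul_assoc, ← mul_sub, norm_mul]
    refine mul_le_of_le_one_left (norm_nonneg _) ?_
    rw [norm_mul, norm_inv, Complex.norm_natCast]
    have : ‖∑ d ∈ D, Complex.exp (L ((realInv M).mulVec (toReal d)) * Complex.I)‖ ≤ D.card := by
      refine (norm_sum_le _ _).trans ?_
      simp [Complex.norm_exp_ofReal_mul_I]
    exact inv_mul_le_one_of_le₀ this (by positivity)
  have hk : ∀ k : ℕ, ‖charFunDual μ L - charFunDual ν L‖ ≤
      ‖charFunDual μ (L ∘L T ^ k) - charFunDual ν (L ∘L T ^ k)‖ := by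
    intro k
    induction k with
    | zero => simp [ContinuousLinearMap.one_def]
    | succ k ih =>
      refine ih.trans ((step _).trans (le_of_eq ?_))
      rw [pow_succ]; rfl
  have hTk : ∀ k v, (T ^ k) v = (realInv M ^ k).mulVec v := by
    intro k
    induction k with
    | zero => intro v; simp
    | succ k ih =>
      intro v
      rw [pow_succ, mul_apply_eq_comp, ih, pow_succ, ← Matrix.mulVec_mulVec]
      rfl
  have hlim : ∀ ρ : Measure (Fin n → ℝ), IsProbabilityMeasure ρ →
      Filter.Tendsto (fun k : ℕ => charFunDual ρ (L ∘L T ^ k)) Filter.atTop (nhds 1) := by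
    intro ρ _
    have h1 : (1 : ℂ) = ∫ v : Fin n → ℝ, (1 : ℂ) ∂ρ := by simp
    rw [h1]
    simp only [charFunDual_apply]
    refine tendsto_integral_of_dominated_convergence (fun _ => 1) (fun k => by fun_prop)
      (integrable_const _) (fun k => Filter.Eventually.of_forall fun v => ?_)
      (Filter.Eventually.of_forall fun v => ?_)
    · rw [Complex.norm_exp_ofReal_mul_I]
    · have h2 : Filter.Tendsto (fun k : ℕ => (L ∘L T ^ k) v) Filter.atTop (nhds 0) := by
        have := (L.continuous.tendsto 0).comp (tendsto_pow_mulVec hM v)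
        rw [map_zero] at this
        refine this.congr fun k => ?_
        simp [hTk]
      have h3 : Continuous fun x : ℝ => Complex.exp (x * Complex.I) := by fun_prop
      have := (h3.tendsto 0).comp h2
      simpa [Function.comp_def] using this
  have h0 := ((hlim μ inferInstance).sub (hlim ν inferInstance)).norm
  rw [sub_self, norm_zero] at h0
  have := ge_of_tendsto' h0 hk
  exact sub_eq_zero.1 (norm_le_zero_iff.1 this)

lemma prod_cons_infinitePi {X : Type*} [MeasurableSpace X] (u : Measure X)
    [IsProbabilityMeasure u] :
    (u.prod (Measure.infinitePi fun _ : ℕ => u)).map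
      (fun q => fun k : ℕ => Nat.casesOn k q.1 q.2) = Measure.infinitePi fun _ : ℕ => u := by
  have hmeas : Measurable (fun q : X × (ℕ → X) => fun k : ℕ => (Nat.casesOn k q.1 q.2 : X)) := by
    rw [measurable_pi_iff]
    rintro (_ | k)
    · exact measurable_fst
    · exact (measurable_pi_apply k).comp measurable_snd
  refine Measure.eq_infinitePi _ fun s t ht => ?_
  rw [Measure.map_apply hmeas (MeasurableSet.pi s.countable_toSet fun i _ => ht i)]
  set s' : Finset ℕ := s.preimage Nat.succ (Nat.succ_injective.injOn) with hs'
  have hpre : (fun q : X × (ℕ → X) => fun k : ℕ => (Nat.casesOn k q.1 q.2 : X)) ⁻¹'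
      (Set.pi s t) = (if 0 ∈ s then t 0 else Set.univ) ×ˢ Set.pi s' (fun k => t (k + 1)) := by
    ext ⟨x, ω⟩
    simp only [Set.mem_preimage, Set.mem_pi, Set.mem_prod, hs', Finset.coe_preimage,
      Finset.mem_coe]
    constructor
    · intro h
      refine ⟨?_, fun k hk => h (k + 1) hk⟩
      split_ifs with h0
      · exact h 0 h0
      · trivial
    · rintro ⟨h0, h1⟩ (_ | k) hk
      · rw [if_pos hk] at h0; exact h0
      · exact h1 k hk
  rw [hpre, Measure.prod_prod, Measure.infinitePi_pi _ (fun i _ => ht _)]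
  have hs : ∏ i ∈ s, u (t i) = (∏ i ∈ s with i = 0, u (t i)) * ∏ i ∈ s with ¬ i = 0, u (t i) :=
    (Finset.prod_filter_mul_prod_filter_not s _ _).symm
  rw [hs]
  congr 1
  · rw [Finset.filter_eq']
    split_ifs <;> simp
  · refine Finset.prod_bij (fun k _ => k + 1) ?_ ?_ ?_ ?_
    · intro k hk; simpa [hs'] using hk
    · intro a _ b _ h; simpa using h
    · intro b hb
      rw [Finset.mem_filter] at hb
      obtain ⟨c, rfl⟩ := Nat.exists_eq_succ_of_ne_zero hb.2
      exact ⟨c, by simpa [hs'] using hb.1, rfl⟩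
    · intros; rfl

lemma exists_selfAffine {M : Matrix (Fin n) (Fin n) ℤ} (hM : IsExpanding M)
    {D : Finset (Fin n → ℤ)} (hD : D.Nonempty) :
    ∃ μ : Measure (Fin n → ℝ), IsSelfAffineMeasure M D μ := by
  have hc0 : (D.card : ℝ≥0∞) ≠ 0 := by simpa using hD.ne_empty
  let u : Measure D := (D.card : ℝ≥0∞)⁻¹ • ∑ d : D, Measure.dirac d
  have hu : IsProbabilityMeasure u := ⟨by
    simp [u, ENNReal.inv_mul_cancel hc0 (ENNReal.natCast_ne_top _)]⟩
  let X : (ℕ → D) → Fin n → ℝ := fun ω i =>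
    ∑' k : ℕ, ((realInv M ^ (k + 1)).mulVec (toReal (ω k).1)) i
  have hsum : ∀ (ω : ℕ → D) (i : Fin n),
      Summable fun k : ℕ => ((realInv M ^ (k + 1)).mulVec (toReal (ω k).1)) i := by
    intro ω i
    simp only [Matrix.mulVec, dotProduct]
    refine summable_sum fun j _ => ?_
    obtain ⟨C, hC⟩ : ∃ C : ℝ, ∀ d : D, |toReal d.1 j| ≤ C :=
      ⟨∑ d : D, |toReal d.1 j|, fun d => Finset.single_le_sum
        (f := fun d : D => |toReal d.1 j|) (fun _ _ => abs_nonneg _) (Finset.mem_univ d)⟩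
    refine Summable.of_norm_bounded
      (((summable_nat_add_iff 1).2 (summable_entry hM i j)).mul_right C) fun k => ?_
    rw [Real.norm_eq_abs, abs_mul]
    exact mul_le_mul_of_nonneg_left (hC _) (abs_nonneg _)
  have hX : Measurable X := by
    rw [measurable_pi_iff]
    intro i
    refine measurable_of_tendsto_metrizable (f := fun (N : ℕ) (ω : ℕ → D) =>
      ∑ k ∈ Finset.range N, ((realInv M ^ (k + 1)).mulVec (toReal (ω k).1)) i) ?_ ?_
    · intro N
      refine Finset.measurable_sum _ fun k _ => ?_
      exact (measurable_of_countable (fun d : D =>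
        ((realInv M ^ (k + 1)).mulVec (toReal d.1)) i)).comp (measurable_pi_apply k)
    · rw [tendsto_pi_nhds]
      exact fun ω => (hsum ω i).hasSum.tendsto_sum_nat
  have hcons : ∀ q : D × (ℕ → D),
      X (fun k => Nat.casesOn k q.1 q.2) = ifsMap M q.1.1 (X q.2) := by
    rintro ⟨d, ω⟩
    ext i
    have h1 := (hsum (fun k => Nat.casesOn k d ω) i).tsum_eq_zero_add
    simp only [X]
    rw [h1]
    simp only [ifsMap, Matrix.mulVec_add, Pi.add_apply, zero_add, pow_one]
    rw [add_comm]
    congr 1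
    have h2 : ∀ k : ℕ, ((realInv M ^ (k + 1 + 1)).mulVec (toReal (ω k).1)) i =
        ∑ j, realInv M i j * ((realInv M ^ (k + 1)).mulVec (toReal (ω k).1)) j := by
      intro k
      rw [pow_succ' _ (k + 1), ← Matrix.mulVec_mulVec]
      rfl
    refine (tsum_congr h2).trans ?_
    rw [Summable.tsum_finsetSum (fun j _ => (hsum ω j).mul_left _)]
    exact Finset.sum_congr rfl fun j _ => tsum_mul_left
  have hconsm : Measurable (fun q : D × (ℕ → D) => fun k : ℕ => (Nat.casesOn k q.1 q.2 : D)) := by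
    rw [measurable_pi_iff]
    rintro (_ | k)
    · exact measurable_fst
    · exact (measurable_pi_apply k).comp measurable_snd
  refine ⟨(Measure.infinitePi fun _ : ℕ => u).map X,
    Measure.isProbabilityMeasure_map hX.aemeasurable, ?_⟩
  conv_lhs => rw [← prod_cons_infinitePi u, Measure.map_map hX hconsm]
  have hcomp : (X ∘ fun q : D × (ℕ → D) => fun k : ℕ => (Nat.casesOn k q.1 q.2 : D)) =
      fun q => ifsMap M q.1.1 (X q.2) := funext hcons
  have hm : Measurable fun q : D × (ℕ → D) => ifsMap M q.1.1 (X q.2) := by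
    rw [← hcomp]; exact hX.comp hconsm
  rw [hcomp]
  ext S hS
  rw [Measure.map_apply hm hS, Measure.prod_apply (hm hS), Measure.smul_apply,
    Measure.finsetSum_apply]
  simp only [u, lintegral_smul_measure, lintegral_finsetSum_measure, lintegral_dirac]
  congr 1
  rw [← Finset.sum_coe_sort D]
  refine Finset.sum_congr rfl fun d _ => ?_
  rw [Measure.map_map (continuous_ifsMap M d.1).measurable hX,
    Measure.map_apply ((continuous_ifsMap M d.1).measurable.comp hX) hS]
  rfl

/-- For an expanding matrix `M` and a nonempty finite digit set `D` there is exactly one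
self-affine probability measure. -/
theorem existsUnique_selfAffine {M : Matrix (Fin n) (Fin n) ℤ} (hM : IsExpanding M)
    {D : Finset (Fin n → ℤ)} (hD : D.Nonempty) :
    ∃! μ : Measure (Fin n → ℝ), IsSelfAffineMeasure M D μ := by
  obtain ⟨μ, hμ⟩ := exists_selfAffine hM hD
  exact ⟨μ, hμ, fun ν hν => unique_selfAffine hM hν hμ⟩

/-- The self-affine measure `μ_{M,D}`: the unique probability measure with
`μ = |D|⁻¹ ∑_{d ∈ D} μ ∘ φ_d⁻¹`. -/
noncomputable def selfAffineMeasure (M : Matrix (Fin n) (Fin n) ℤ) (D : Finset (Fin n → ℤ))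
    (hM : IsExpanding M) (hD : D.Nonempty) : Measure (Fin n → ℝ) :=
  (existsUnique_selfAffine hM hD).choose

theorem selfAffineMeasure_spec (M : Matrix (Fin n) (Fin n) ℤ) (D : Finset (Fin n → ℤ))
    (hM : IsExpanding M) (hD : D.Nonempty) :
    IsSelfAffineMeasure M D (selfAffineMeasure M D hM hD) :=
  (existsUnique_selfAffine hM hD).choose_spec.1

instance (M : Matrix (Fin n) (Fin n) ℤ) (D : Finset (Fin n → ℤ))
    (hM : IsExpanding M) (hD : D.Nonempty) :
    IsProbabilityMeasure (selfAffineMeasure M D hM hD) :=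
  (selfAffineMeasure_spec M D hM hD).isProbabilityMeasure

/-- The mask polynomial `m_D(x) = |D|⁻¹ ∑_{d ∈ D} exp(2πi⟨d, x⟩)`. -/
noncomputable def maskPoly (D : Finset (Fin n → ℤ)) (x : Fin n → ℝ) : ℂ :=
  (D.card : ℂ)⁻¹ * ∑ d ∈ D,
    Complex.exp (2 * Real.pi * Complex.I * ((toReal d ⬝ᵥ x : ℝ) : ℂ))

/-- The zeros of the mask polynomial in the unit cube `[0,1)ⁿ`. -/
def maskZeros (D : Finset (Fin n → ℤ)) : Set (Fin n → ℝ) :=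
  {x | maskPoly D x = 0 ∧ ∀ i, x i ∈ Set.Ico (0 : ℝ) 1}

/-- The nonzero vectors of the form `(l₁, …, lₙ) / q` with integers `0 ≤ lᵢ ≤ q - 1`. -/
def puncturedGrid (n q : ℕ) : Set (Fin n → ℝ) :=
  {x | x ≠ 0 ∧ ∃ l : Fin n → ℕ, (∀ i, l i < q) ∧ ∀ i, x i = (l i : ℝ) / (q : ℝ)}

/-- Reduction modulo `p` of an integer matrix. -/
def modMatrix (p : ℕ) (A : Matrix (Fin n) (Fin n) ℤ) : Matrix (Fin n) (Fin n) (ZMod p) :=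
  A.map (fun a : ℤ => (a : ZMod p))

/-- The pairs `(M, D)` and `(M', D')` are conjugate in `GL_n(p)`. -/
def ConjugateInGL (p : ℕ) (M : Matrix (Fin n) (Fin n) ℤ) (D : Finset (Fin n → ℤ))
    (M' : Matrix (Fin n) (Fin n) ℤ) (D' : Finset (Fin n → ℤ)) : Prop :=
  ∃ A B : Matrix (Fin n) (Fin n) ℤ,
    IsUnit (modMatrix p A) ∧ IsUnit (modMatrix p B) ∧ modMatrix p (A * B) = 1 ∧
    M' = A * M * B ∧ (D = D'.image B.mulVec ∨ D' = D.image A.mulVec)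

/-- The exponential function `x ↦ exp(2πi⟨lam, x⟩)` on `ℝⁿ`. -/
noncomputable def expFun (lam x : Fin n → ℝ) : ℂ :=
  Complex.exp (2 * Real.pi * Complex.I * ((lam ⬝ᵥ x : ℝ) : ℂ))

lemma memLp_expFun (μ : Measure (Fin n → ℝ)) [IsFiniteMeasure μ] (lam : Fin n → ℝ) :
    MemLp (expFun lam) 2 μ := by
  have hc : Continuous (expFun lam) := by
    unfold expFun dotProduct
    fun_prop
  refine MemLp.of_bound hc.aestronglyMeasurable 1 (Filter.Eventually.of_forall fun x => ?_)
  have h : 2 * Real.pi * Complex.I * ((lam ⬝ᵥ x : ℝ) : ℂ) =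
      ((2 * Real.pi * (lam ⬝ᵥ x) : ℝ) : ℂ) * Complex.I := by
    push_cast
    ring
  rw [expFun, h, Complex.norm_exp_ofReal_mul_I]

/-- The exponential function with frequency `lam`, as an element of `L²(μ)`. -/
noncomputable def expL2 (μ : Measure (Fin n → ℝ)) [IsFiniteMeasure μ] (lam : Fin n → ℝ) :
    Lp ℂ 2 μ :=
  (memLp_expFun μ lam).toLp (expFun lam)

/-- `E(Λ)` is an orthogonal set of exponentials in `L²(μ)`: exponentials with distinct
frequencies in `Λ` are orthogonal. -/
def OrthogonalExps (μ : Measure (Fin n → ℝ)) [IsFiniteMeasure μ] (Λ : Set (Fin n → ℝ)) : Prop :=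
  Λ.Pairwise fun a b => inner ℂ (expL2 μ a) (expL2 μ b) = 0

/-- `L²(μ)` has infinitely many mutually orthogonal exponentials. -/
def HasInfiniteOrthogonalExps (μ : Measure (Fin n → ℝ)) [IsFiniteMeasure μ] : Prop :=
  ∃ Λ : Set (Fin n → ℝ), Λ.Infinite ∧ OrthogonalExps μ Λ

/-- The maximal cardinality `n*(μ)` of orthogonal exponentials in `L²(μ)`: the supremum of the
cardinalities of the finite or countable `Λ` for which `E(Λ)` is a maximal orthogonal set of
exponentials. -/
noncomputable def maxOrthogonalCard (μ : Measure (Fin n → ℝ)) [IsFiniteMeasure μ] : ℕ∞ :=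
  ⨆ Λ ∈ {Λ : Set (Fin n → ℝ) | Λ.Countable ∧ Maximal (OrthogonalExps μ) Λ}, Λ.encard

end SelfAffine

/-! Two exponentials are orthogonal exactly when the Fourier transform of the measure vanishes at
the difference of their frequencies. Iterating self-similarity factors this transform into values of
the mask polynomial, so its zeros are the vectors `(Mᵀ)^(j+1) z` with `z` a zero of `m_D`
(`fourier_eq_zero_iff_exists`). The grid hypothesis puts the zeros of `m_D` in `p⁻¹ ℤⁿ`, and they
are periodic under `ℤⁿ`; hence `E = gridZeros p D` is a union of residue classes mod `p`. When the
digits are `A D`, the zeros are pulled back by `Aᵀ`, and the adjugate clears denominators. So for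
both measures the zero set, scaled by some `Q`, is an `orbit P C E` with the same `E`
(`fourier_image_eq_zero_iff`).

Reducing an orthogonal set mod `p` gives a map into `(ZMod p)ⁿ` whose differences lie in the reduced
orbit `S`. If `0 ∉ S` this map is injective, so orthogonal sets have at most `cliqueNum S ≤ p ^ n`
elements; if `0 ∈ S`, powers of `P` give an explicit infinite family
(`hasInfiniteOrthogonalExps_iff`). If `P` is invertible mod `p` and `0 ∉ S`, every clique of `S`
lifts back to an orthogonal set (`maxOrthogonalCard_eq`). Both invariants therefore depend only on
`S`, and conjugacy mod `p` carries one reduced orbit onto the other by an invertible linear map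
(`modVec_image_orbit`). -/

namespace SelfAffine

variable {n : ℕ}

/-! ### Fourier transforms of self-affine measures and their zeros -/

/-- The Fourier transform of `μ`. -/
noncomputable def fourier (μ : Measure (Fin n → ℝ)) (ξ : Fin n → ℝ) : ℂ :=
  ∫ x, expFun ξ x ∂μ

lemma inner_expL2 (μ : Measure (Fin n → ℝ)) [IsFiniteMeasure μ] (a b : Fin n → ℝ) :
    inner ℂ (expL2 μ a) (expL2 μ b) = fourier μ (b - a) := by
  rw [L2.inner_def, fourier]
  refine integral_congr_ae ?_
  filter_upwards [(memLp_expFun μ a).coeFn_toLp, (memLp_expFun μ b).coeFn_toLp] with x ha hb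
  rw [expL2, expL2, ha, hb, RCLike.inner_apply, expFun, expFun, expFun, ← Complex.exp_conj,
    ← Complex.exp_add]
  congr 1
  simp only [map_mul, Complex.conj_I, Complex.conj_ofReal, map_ofNat, sub_dotProduct]
  push_cast
  ring

/-- The functional `x ↦ 2π⟨ξ, x⟩`. -/
noncomputable def phase (ξ : Fin n → ℝ) : StrongDual ℝ (Fin n → ℝ) :=
  ∑ i, (2 * Real.pi * ξ i) • ContinuousLinearMap.proj i

lemma phase_apply (ξ x : Fin n → ℝ) : phase ξ x = 2 * Real.pi * (ξ ⬝ᵥ x) := by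
  simp [phase, dotProduct, Finset.mul_sum, mul_assoc]

lemma exp_phase (ξ x : Fin n → ℝ) : Complex.exp (phase ξ x * Complex.I) = expFun ξ x := by
  rw [phase_apply, expFun]
  congr 1
  push_cast
  ring

/-- Makes the functional equation `charFun_selfAffine` available for `fourier`. -/
lemma charFunDual_phase (μ : Measure (Fin n → ℝ)) (ξ : Fin n → ℝ) :
    charFunDual μ (phase ξ) = fourier μ ξ := by
  rw [charFunDual_apply, fourier]
  simp only [exp_phase]

lemma phase_comp (N : Matrix (Fin n) (Fin n) ℝ) (ξ : Fin n → ℝ) :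
    phase ξ ∘L (Matrix.mulVecLin N).toContinuousLinearMap = phase (N.transpose.mulVec ξ) := by
  ext1 x
  simp [phase_apply, Matrix.mulVec_transpose, Matrix.dotProduct_mulVec]

lemma fourier_selfAffine {M : Matrix (Fin n) (Fin n) ℤ} {D : Finset (Fin n → ℤ)}
    {μ : Measure (Fin n → ℝ)} (h : IsSelfAffineMeasure M D μ) (ξ : Fin n → ℝ) :
    fourier μ ξ = maskPoly D ((realInv M).transpose.mulVec ξ) *
      fourier μ ((realInv M).transpose.mulVec ξ) := by
  rw [← charFunDual_phase, charFun_selfAffine h, phase_comp, charFunDual_phase,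
    ← Finset.sum_mul, ← mul_assoc, maskPoly]
  congr 2
  refine Finset.sum_congr rfl fun d _ => ?_
  rw [exp_phase, expFun, Matrix.dotProduct_mulVec, dotProduct_comm, Matrix.mulVec_transpose]

lemma fourier_iterate {M : Matrix (Fin n) (Fin n) ℤ} {D : Finset (Fin n → ℤ)}
    {μ : Measure (Fin n → ℝ)} (h : IsSelfAffineMeasure M D μ) (ξ : Fin n → ℝ) (k : ℕ) :
    fourier μ ξ = (∏ j ∈ Finset.range k,
      maskPoly D (((realInv M).transpose ^ (j + 1)).mulVec ξ)) *
      fourier μ (((realInv M).transpose ^ k).mulVec ξ) := by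
  induction k with
  | zero => simp
  | succ k ih =>
    rw [ih, fourier_selfAffine h, Matrix.mulVec_mulVec, ← pow_succ', Finset.prod_range_succ,
      mul_assoc]

lemma tendsto_transpose_pow_mulVec {M : Matrix (Fin n) (Fin n) ℤ} (hM : IsExpanding M)
    (v : Fin n → ℝ) :
    Filter.Tendsto (fun k : ℕ => ((realInv M).transpose ^ k).mulVec v) Filter.atTop
      (nhds 0) := by
  rw [tendsto_pi_nhds]
  intro i
  have : Filter.Tendsto (fun k : ℕ => ∑ j, (realInv M ^ k) j i * v j) Filter.atTop
      (nhds (∑ j, 0 * v j)) :=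
    tendsto_finsetSum _ fun j _ =>
      ((summable_entry hM j i).of_abs.tendsto_atTop_zero).mul_const _
  simpa [Matrix.mulVec, dotProduct, ← Matrix.transpose_pow] using this

lemma tendsto_fourier {M : Matrix (Fin n) (Fin n) ℤ} (hM : IsExpanding M)
    (μ : Measure (Fin n → ℝ)) [IsProbabilityMeasure μ] (ξ : Fin n → ℝ) :
    Filter.Tendsto (fun k : ℕ => fourier μ (((realInv M).transpose ^ k).mulVec ξ)) Filter.atTop
      (nhds 1) := by
  have h1 : (1 : ℂ) = ∫ v : Fin n → ℝ, (1 : ℂ) ∂μ := by simp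
  rw [h1]
  refine tendsto_integral_of_dominated_convergence (fun _ => 1)
    (fun k => (memLp_expFun μ _).aestronglyMeasurable)
    (integrable_const _) (fun k => Filter.Eventually.of_forall fun v => ?_)
    (Filter.Eventually.of_forall fun v => ?_)
  · rw [← exp_phase, Complex.norm_exp_ofReal_mul_I]
  · have hc : Continuous fun η : Fin n → ℝ => expFun η v := by
      unfold expFun dotProduct
      fun_prop
    have := (hc.tendsto 0).comp (tendsto_transpose_pow_mulVec hM ξ)
    simpa [Function.comp_def, expFun] using this

/-- No infinite product is needed: the remainder factor after `k` steps tends to `1`, so for some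
`k` it is nonzero, and a zero must come from one of finitely many mask factors. -/
lemma fourier_eq_zero_iff {M : Matrix (Fin n) (Fin n) ℤ} (hM : IsExpanding M)
    {D : Finset (Fin n → ℤ)} {μ : Measure (Fin n → ℝ)} (h : IsSelfAffineMeasure M D μ)
    (ξ : Fin n → ℝ) :
    fourier μ ξ = 0 ↔ ∃ j : ℕ, maskPoly D (((realInv M).transpose ^ (j + 1)).mulVec ξ) = 0 := by
  have := h.isProbabilityMeasure
  constructor
  · intro h0
    obtain ⟨k, hk⟩ := ((tendsto_fourier hM μ ξ).eventually_ne one_ne_zero).exists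
    rw [fourier_iterate h ξ k] at h0
    obtain ⟨j, -, hj⟩ := Finset.prod_eq_zero_iff.1 ((mul_eq_zero.1 h0).resolve_right hk)
    exact ⟨j, hj⟩
  · rintro ⟨j, hj⟩
    rw [fourier_iterate h ξ (j + 1), Finset.prod_range_succ, hj, mul_zero, zero_mul]

lemma IsExpanding.det_ne_zero {M : Matrix (Fin n) (Fin n) ℤ} (hM : IsExpanding M) :
    M.det ≠ 0 := by
  intro h
  have h0 : (0 : ℂ) ∉ spectrum ℂ (M.map (fun a : ℤ => (a : ℂ))) := fun h => by
    have := hM 0 h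
    norm_num at this
  have hu := (Matrix.isUnit_iff_isUnit_det _).1 (spectrum.zero_notMem_iff ℂ |>.1 h0)
  have : (M.map (fun a : ℤ => (a : ℂ))).det = (M.det : ℂ) :=
    (RingHom.map_det (Int.castRingHom ℂ) M).symm
  rw [this, h] at hu
  simp at hu

lemma IsExpanding.transpose_mul_realInv {M : Matrix (Fin n) (Fin n) ℤ} (hM : IsExpanding M) :
    (M.map (fun a : ℤ => (a : ℝ))).transpose * (realInv M).transpose = 1 := by
  have : (M.map (fun a : ℤ => (a : ℝ))).det = (M.det : ℝ) :=
    (RingHom.map_det (Int.castRingHom ℝ) M).symm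
  rw [← Matrix.transpose_mul, realInv, Matrix.nonsing_inv_mul _ (by
    rw [this, isUnit_iff_ne_zero]; exact_mod_cast hM.det_ne_zero), Matrix.transpose_one]

lemma fourier_eq_zero_iff_exists {M : Matrix (Fin n) (Fin n) ℤ} (hM : IsExpanding M)
    {D : Finset (Fin n → ℤ)} {μ : Measure (Fin n → ℝ)} (h : IsSelfAffineMeasure M D μ)
    (ξ : Fin n → ℝ) :
    fourier μ ξ = 0 ↔ ∃ (j : ℕ) (z : Fin n → ℝ), maskPoly D z = 0 ∧
      ξ = ((M.map (fun a : ℤ => (a : ℝ))).transpose ^ (j + 1)).mulVec z := by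
  have h1 := hM.transpose_mul_realInv
  have h2 := mul_eq_one_comm.1 h1
  have hc : Commute (M.map (fun a : ℤ => (a : ℝ))).transpose (realInv M).transpose := by
    rw [Commute, SemiconjBy, h1, h2]
  rw [fourier_eq_zero_iff hM h]
  constructor
  · rintro ⟨j, hj⟩
    refine ⟨j, _, hj, ?_⟩
    rw [Matrix.mulVec_mulVec, ← hc.mul_pow, h1, one_pow, Matrix.one_mulVec]
  · rintro ⟨j, z, hz, rfl⟩
    refine ⟨j, ?_⟩
    rwa [Matrix.mulVec_mulVec, ← hc.symm.mul_pow, h2, one_pow, Matrix.one_mulVec]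

/-! ### Symmetries of the mask polynomial -/

lemma maskPoly_zero {D : Finset (Fin n → ℤ)} (hD : D.Nonempty) : maskPoly D 0 = 1 := by
  have : (D.card : ℂ) ≠ 0 := by simpa using hD.ne_empty
  simp [maskPoly, this]

lemma maskPoly_add_toReal (D : Finset (Fin n → ℤ)) (x : Fin n → ℝ) (y : Fin n → ℤ) :
    maskPoly D (x + toReal y) = maskPoly D x := by
  unfold maskPoly
  congr 1
  refine Finset.sum_congr rfl fun d _ => ?_
  have : toReal d ⬝ᵥ toReal y = ((d ⬝ᵥ y : ℤ) : ℝ) := by simp [toReal, dotProduct]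
  rw [dotProduct_add, this, Complex.exp_eq_exp_iff_exists_int]
  refine ⟨d ⬝ᵥ y, ?_⟩
  push_cast
  ring

lemma maskPoly_neg (D : Finset (Fin n → ℤ)) (x : Fin n → ℝ) :
    maskPoly D (-x) = starRingEnd ℂ (maskPoly D x) := by
  simp only [maskPoly, map_mul, map_inv₀, map_natCast, map_sum, ← Complex.exp_conj]
  congr 1
  refine Finset.sum_congr rfl fun d _ => ?_
  congr 1
  simp only [dotProduct_neg, map_ofNat, Complex.conj_I, Complex.conj_ofReal]
  push_cast
  ring

lemma toReal_mulVec (A : Matrix (Fin n) (Fin n) ℤ) (d : Fin n → ℤ) :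
    toReal (A.mulVec d) = (A.map (fun a : ℤ => (a : ℝ))).mulVec (toReal d) := by
  ext i
  simp [toReal, Matrix.mulVec, dotProduct]

lemma maskPoly_image {A : Matrix (Fin n) (Fin n) ℤ} (hA : A.det ≠ 0) (D : Finset (Fin n → ℤ))
    (x : Fin n → ℝ) :
    maskPoly (D.image A.mulVec) x =
      maskPoly D ((A.map (fun a : ℤ => (a : ℝ))).transpose.mulVec x) := by
  have hinj : Function.Injective A.mulVec := by
    intro x y hxy
    rw [← sub_eq_zero]
    refine Matrix.eq_zero_of_mulVec_eq_zero hA ?_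
    rw [Matrix.mulVec_sub, sub_eq_zero]
    exact hxy
  rw [maskPoly, maskPoly, Finset.card_image_of_injective _ hinj,
    Finset.sum_image hinj.injOn]
  congr 1
  refine Finset.sum_congr rfl fun d _ => ?_
  rw [toReal_mulVec, Matrix.dotProduct_mulVec, Matrix.vecMul_transpose]


/-! ### Reduction mod `p`, orthogonal sets, and cliques of difference sets -/

/-- Reduction modulo `p` of an integer vector. -/
def modVec (p : ℕ) (v : Fin n → ℤ) : Fin n → ZMod p := fun i => (v i : ZMod p)

lemma modVec_sub (p : ℕ) (v w : Fin n → ℤ) : modVec p (v - w) = modVec p v - modVec p w := by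
  ext i; simp [modVec]

lemma modVec_smul (p : ℕ) (c : ℤ) (v : Fin n → ℤ) :
    modVec p (c • v) = (c : ZMod p) • modVec p v := by
  ext i; simp [modVec]

lemma modVec_neg (p : ℕ) (v : Fin n → ℤ) : modVec p (-v) = -modVec p v := by
  ext i; simp [modVec]

lemma modVec_surjective (p : ℕ) : Function.Surjective (modVec (n := n) p) := fun v =>
  ⟨fun i => (v i).cast, by ext i; simp [modVec]⟩

lemma modVec_mulVec (p : ℕ) (A : Matrix (Fin n) (Fin n) ℤ) (v : Fin n → ℤ) :
    modVec p (A.mulVec v) = (modMatrix p A).mulVec (modVec p v) := by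
  ext i; simp [modVec, modMatrix, Matrix.mulVec, dotProduct]

lemma modMatrix_mul (p : ℕ) (A B : Matrix (Fin n) (Fin n) ℤ) :
    modMatrix p (A * B) = modMatrix p A * modMatrix p B :=
  (Int.castRingHom (ZMod p)).mapMatrix.map_mul A B

lemma modMatrix_pow (p : ℕ) (A : Matrix (Fin n) (Fin n) ℤ) (k : ℕ) :
    modMatrix p (A ^ k) = modMatrix p A ^ k :=
  (Int.castRingHom (ZMod p)).mapMatrix.map_pow A k

lemma modMatrix_transpose (p : ℕ) (A : Matrix (Fin n) (Fin n) ℤ) :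
    modMatrix p A.transpose = (modMatrix p A).transpose := rfl

lemma modMatrix_smul_one (p : ℕ) (c : ℤ) :
    modMatrix p (c • (1 : Matrix (Fin n) (Fin n) ℤ)) = (c : ZMod p) • 1 := by
  ext i j
  simp only [modMatrix, Matrix.map_apply, Matrix.smul_apply, Matrix.one_apply]
  split_ifs <;> simp

lemma det_modMatrix (p : ℕ) (A : Matrix (Fin n) (Fin n) ℤ) :
    (modMatrix p A).det = (A.det : ZMod p) :=
  (RingHom.map_det (Int.castRingHom (ZMod p)) A).symm

lemma toReal_injective : Function.Injective (toReal (n := n)) := fun v w h => by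
  ext i
  exact Int.cast_injective (α := ℝ) (congrFun h i)

lemma toReal_sub (v w : Fin n → ℤ) : toReal (v - w) = toReal v - toReal w := by
  ext i; simp [toReal]

lemma fourier_zero (μ : Measure (Fin n → ℝ)) [IsProbabilityMeasure μ] : fourier μ 0 = 1 := by
  simp [fourier, expFun]

lemma orthogonalExps_iff (μ : Measure (Fin n → ℝ)) [IsFiniteMeasure μ]
    (Λ : Set (Fin n → ℝ)) :
    OrthogonalExps μ Λ ↔ Λ.Pairwise fun a b => fourier μ (b - a) = 0 := by
  simp only [OrthogonalExps, inner_expL2]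

/-- Zorn's lemma: orthogonality is a pairwise condition, so it passes to unions of chains. -/
lemma exists_maximal_orthogonalExps (μ : Measure (Fin n → ℝ)) [IsFiniteMeasure μ]
    {Λ : Set (Fin n → ℝ)} (hΛ : OrthogonalExps μ Λ) :
    ∃ Λ', Λ ⊆ Λ' ∧ Maximal (OrthogonalExps μ) Λ' := by
  refine zorn_subset_nonempty {Λ | OrthogonalExps μ Λ} (fun c hc hchain _ => ?_) Λ hΛ
  refine ⟨⋃₀ c, ?_, fun s hs => Set.subset_sUnion_of_mem hs⟩
  exact (Set.pairwise_sUnion hchain.directedOn).2 hc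

/-- The integer vectors `P ^ (j + 1) C e` with `e ∈ E`. -/
def orbit (P C : Matrix (Fin n) (Fin n) ℤ) (E : Set (Fin n → ℤ)) : Set (Fin n → ℤ) :=
  {x | ∃ (j : ℕ) (e : Fin n → ℤ), e ∈ E ∧ x = (P ^ (j + 1)).mulVec (C.mulVec e)}

/-- The largest size of a set in `G` whose differences of distinct elements lie in `S`. -/
noncomputable def cliqueNum {G : Type*} [AddGroup G] (S : Set G) : ℕ∞ :=
  ⨆ K ∈ {K : Set G | K.Pairwise fun a b => b - a ∈ S}, K.encard

lemma cliqueNum_le_card {G : Type*} [AddGroup G] (S : Set G) : cliqueNum S ≤ ENat.card G :=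
  iSup₂_le fun K _ => (Set.encard_le_encard (Set.subset_univ K)).trans_eq (Set.encard_univ G)

lemma cliqueNum_le_of_map {G H : Type*} [AddGroup G] [AddGroup H] {S : Set G} {S' : Set H}
    (φ : G → H) (hφ : Function.Injective φ) (hsub : ∀ a b, φ (a - b) = φ a - φ b)
    (h : ∀ s ∈ S, φ s ∈ S') : cliqueNum S ≤ cliqueNum S' := by
  refine iSup₂_le fun K hK => ?_
  rw [← hφ.encard_image K]
  refine le_iSup₂_of_le (φ '' K) ?_ le_rfl
  rintro _ ⟨a, ha, rfl⟩ _ ⟨b, hb, rfl⟩ hab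
  rw [← hsub]
  exact h _ (hK ha hb fun h => hab (h ▸ rfl))

/-! ### Measures whose Fourier zeros form a scaled integer orbit -/

section model

variable {p : ℕ} {P C T : Matrix (Fin n) (Fin n) ℤ} {E : Set (Fin n → ℤ)} {δ : ℤ} {Q : ℝ}
  {μ : Measure (Fin n → ℝ)} [IsProbabilityMeasure μ]

lemma zero_notMem_orbit
    (hμ : ∀ ξ, fourier μ ξ = 0 ↔ ∃ x ∈ orbit P C E, Q • ξ = toReal x) :
    (0 : Fin n → ℤ) ∉ orbit P C E := fun h => by
  have := (hμ 0).2 ⟨0, h, by ext i; simp [toReal]⟩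
  rw [fourier_zero] at this
  exact one_ne_zero this

/-- Differences from a fixed base point `l ∈ Λ` become integer vectors after scaling by `Q`, so they
can be reduced mod `p`; the base point cancels in differences. -/
lemma OrthogonalExps.exists_map
    (hμ : ∀ ξ, fourier μ ξ = 0 ↔ ∃ x ∈ orbit P C E, Q • ξ = toReal x)
    {Λ : Set (Fin n → ℝ)} (hΛ : OrthogonalExps μ Λ) :
    ∃ f : (Fin n → ℝ) → (Fin n → ZMod p),
      Λ.Pairwise fun a b => f b - f a ∈ modVec p '' orbit P C E := by
  rw [orthogonalExps_iff] at hΛ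
  rcases Λ.eq_empty_or_nonempty with rfl | ⟨l, hl⟩
  · exact ⟨0, Set.pairwise_empty _⟩
  have : ∀ a, ∃ x : Fin n → ℤ, a ∈ Λ → Q • (a - l) = toReal x := by
    intro a
    by_cases ha : a ∈ Λ
    · by_cases hal : a = l
      · exact ⟨0, fun _ => by ext i; simp [toReal, hal]⟩
      · obtain ⟨x, -, hx⟩ := (hμ _).1 (hΛ hl ha (Ne.symm hal))
        exact ⟨x, fun _ => hx⟩
    · exact ⟨0, fun h => absurd h ha⟩
  choose g hg using this
  refine ⟨fun a => modVec p (g a), fun a ha b hb hab => ?_⟩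
  obtain ⟨x, hx, hxe⟩ := (hμ _).1 (hΛ ha hb hab)
  refine ⟨x, hx, ?_⟩
  rw [← modVec_sub]
  congr 1
  apply toReal_injective
  rw [← hxe, toReal_sub, ← hg a ha, ← hg b hb, ← smul_sub]
  congr 1
  abel

/-- Since `0` is not an allowed difference, the reduction map cannot identify two frequencies, and
its image is a clique. -/
lemma OrthogonalExps.encard_le_cliqueNum
    (hμ : ∀ ξ, fourier μ ξ = 0 ↔ ∃ x ∈ orbit P C E, Q • ξ = toReal x)
    (h0 : (0 : Fin n → ZMod p) ∉ modVec p '' orbit P C E)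
    {Λ : Set (Fin n → ℝ)} (hΛ : OrthogonalExps μ Λ) :
    Λ.encard ≤ cliqueNum (modVec p '' orbit P C E) := by
  obtain ⟨f, hf⟩ := hΛ.exists_map (p := p) hμ
  have hinj : Set.InjOn f Λ := by
    intro a ha b hb hab
    by_contra hne
    have := hf ha hb hne
    simp only [hab, sub_self] at this
    exact h0 this
  rw [← hinj.encard_image]
  refine le_iSup₂_of_le (f '' Λ) ?_ le_rfl
  rintro _ ⟨a, ha, rfl⟩ _ ⟨b, hb, rfl⟩ hab
  exact hf ha hb fun h => hab (h ▸ rfl)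

/-- A set of integer vectors with differences in the orbit, scaled, gives orthogonal
exponentials. -/
lemma orthogonalExps_image
    (hμ : ∀ ξ, fourier μ ξ = 0 ↔ ∃ x ∈ orbit P C E, Q • ξ = toReal x) (hQ : Q ≠ 0)
    {X : Set (Fin n → ℤ)} (hX : X.Pairwise fun a b => b - a ∈ orbit P C E) :
    OrthogonalExps μ ((fun x => Q⁻¹ • toReal x) '' X) := by
  rw [orthogonalExps_iff]
  rintro _ ⟨a, ha, rfl⟩ _ ⟨b, hb, rfl⟩ hab
  refine (hμ _).2 ⟨_, hX ha hb fun h => hab (h ▸ rfl), ?_⟩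
  rw [← smul_sub, smul_inv_smul₀ hQ, toReal_sub]

lemma injective_inv_smul_toReal (hQ : Q ≠ 0) :
    Function.Injective fun x : Fin n → ℤ => Q⁻¹ • toReal x :=
  (smul_right_injective _ (inv_ne_zero hQ)).comp toReal_injective

/-- Vectors congruent to elements of `C E` lie in `C E` after scaling by a fixed integer. -/
lemma exists_smul_mem [Fact p.Prime] (hCT : C * T = δ • 1)
    (hTC : T * C = δ • 1) (hδ : (δ : ZMod p) ≠ 0)
    (hE : ∀ e e', modVec p e = modVec p e' → e ∈ E → e' ∈ E) :
    ∃ κ : ℤ, ∀ x, ∀ e ∈ E, modVec p x = modVec p (C.mulVec e) →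
      ∃ e' ∈ E, κ • x = C.mulVec e' := by
  -- With `c` inverse to `δ` mod `p`, the witness `e' = c T x` satisfies `e' ≡ c δ e ≡ e`, hence
  -- lies in `E`, while `C e' = c δ x` exactly.
  obtain ⟨c, hc⟩ := ZMod.intCast_surjective ((δ : ZMod p)⁻¹)
  refine ⟨δ * c, fun x e he hx => ⟨(c • T).mulVec x, hE e _ ?_ he, ?_⟩⟩
  · rw [Matrix.smul_mulVec, modVec_smul, modVec_mulVec, hx, ← modVec_mulVec,
      Matrix.mulVec_mulVec, hTC, modVec_mulVec, modMatrix_smul_one, Matrix.smul_mulVec,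
      Matrix.one_mulVec, smul_smul, hc, inv_mul_cancel₀ hδ, one_smul]
  · rw [Matrix.mulVec_mulVec, Matrix.mul_smul, hCT, Matrix.smul_mulVec, Matrix.smul_mulVec,
      Matrix.one_mulVec, smul_smul, mul_comm]

/-- Pigeonhole in the finite set `(ZMod p)ⁿ` gives one direction. Conversely, if `P^(j+1) C e ≡ 0`,
then subtracting `C e` from any later multiple of this power leaves something congruent to `C (-e)`,
which after scaling by `κ` lies in `C E`. -/
lemma hasInfiniteOrthogonalExps_iff [Fact p.Prime]
    (hμ : ∀ ξ, fourier μ ξ = 0 ↔ ∃ x ∈ orbit P C E, Q • ξ = toReal x) (hQ : Q ≠ 0)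
    (hCT : C * T = δ • 1) (hTC : T * C = δ • 1) (hδ : (δ : ZMod p) ≠ 0)
    (hE : ∀ e e', modVec p e = modVec p e' → e ∈ E → e' ∈ E) (hneg : ∀ e ∈ E, -e ∈ E) :
    HasInfiniteOrthogonalExps μ ↔ (0 : Fin n → ZMod p) ∈ modVec p '' orbit P C E := by
  constructor
  · rintro ⟨Λ, hinf, hΛ⟩
    obtain ⟨f, hf⟩ := hΛ.exists_map (p := p) hμ
    obtain ⟨a, ha, b, hb, hab, hfab⟩ :=
      hinf.exists_ne_map_eq_of_mapsTo (Set.mapsTo_univ f Λ) Set.finite_univ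
    have := hf ha hb hab
    simpa only [hfab, sub_self] using this
  · rintro ⟨_, ⟨j, e, he, rfl⟩, h0⟩
    obtain ⟨κ, hκ⟩ := exists_smul_mem hCT hTC hδ hE
    let s : ℕ → Fin n → ℤ := fun k =>
      κ • (P ^ ((j + 1) * (k + 1))).mulVec (C.mulVec e)
    have hlt : ∀ k l, k < l → s l - s k ∈ orbit P C E := by
      intro k l hkl
      obtain ⟨m, rfl⟩ := Nat.exists_eq_add_of_lt hkl
      obtain ⟨e', he', h⟩ := hκ
        ((P ^ ((j + 1) * (m + 1))).mulVec (C.mulVec e) - C.mulVec e) (-e) (hneg e he) (by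
          rw [modVec_sub, Matrix.mulVec_neg, modVec_neg, mul_add_one, pow_add,
            ← Matrix.mulVec_mulVec]
          rw [modVec_mulVec, h0, Matrix.mulVec_zero, zero_sub])
      -- The common factor of `s k` and `s l` is `P ^ ((j + 1) * (k + 1))`; the orbit adds one to
      -- its index, and `(j + 1) * k + j + 1` is this exponent.
      refine ⟨(j + 1) * k + j, e', he', ?_⟩
      rw [← h, Matrix.mulVec_smul, Matrix.mulVec_sub, Matrix.mulVec_mulVec, ← pow_add, smul_sub]
      simp only [s]
      congr 4
      ring
    have hpair : (Set.range s).Pairwise fun a b => b - a ∈ orbit P C E := by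
      rintro _ ⟨k, rfl⟩ _ ⟨l, rfl⟩ hne
      rcases lt_trichotomy k l with h | h | h
      · exact hlt k l h
      · exact absurd (h ▸ rfl) hne
      · obtain ⟨i, e, he, h⟩ := hlt l k h
        refine ⟨i, -e, hneg e he, ?_⟩
        rw [Matrix.mulVec_neg, Matrix.mulVec_neg, ← h, neg_sub]
    have hinj : Function.Injective s := by
      intro k l hkl
      by_contra hne
      rcases lt_or_gt_of_ne hne with h | h
      · have := hlt k l h
        rw [hkl, sub_self] at this
        exact zero_notMem_orbit hμ this
      · have := hlt l k h
        rw [hkl, sub_self] at this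
        exact zero_notMem_orbit hμ this
    exact ⟨_, (Set.infinite_range_of_injective hinj).image (injective_inv_smul_toReal hQ).injOn,
      orthogonalExps_image hμ hQ hpair⟩

/-- A vector congruent to an orbit element need not lie in the orbit. One linear map, independent of
the vector, repairs this: with `N` the order of `P` mod `p`, a power of `P` brings `x` to the class
of some `C e`, `κ` moves it into `C E`, and further powers complete the total to `P ^ N`. Linearity
lets the map act on differences. -/
lemma exists_map_mem_orbit [Fact p.Prime] (hP : IsUnit (modMatrix p P))
    (hCT : C * T = δ • 1) (hTC : T * C = δ • 1) (hδ : (δ : ZMod p) ≠ 0)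
    (hE : ∀ e e', modVec p e = modVec p e' → e ∈ E → e' ∈ E) :
    ∃ A : Matrix (Fin n) (Fin n) ℤ,
      ∀ x, modVec p x ∈ modVec p '' orbit P C E → A.mulVec x ∈ orbit P C E := by
  obtain ⟨κ, hκ⟩ := exists_smul_mem hCT hTC hδ hE
  obtain ⟨u, hu⟩ := hP
  obtain ⟨N, hN, huN⟩ := (isOfFinOrder_of_finite u).exists_pow_eq_one
  have hPN : modMatrix p P ^ N = 1 := by rw [← hu, ← Units.val_pow_eq_pow_val, huN, Units.val_one]
  refine ⟨κ • P ^ N, ?_⟩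
  rintro x ⟨_, ⟨j, e, he, rfl⟩, hx⟩
  have hj := Nat.mod_lt j hN
  -- Reducing `j` mod `N` keeps the exponent a natural number; together with `j + 1` it adds up to a
  -- multiple of `N`.
  obtain ⟨e', he', h⟩ := hκ ((P ^ (N - (j % N + 1))).mulVec x) e he (by
    have hexp : N - (j % N + 1) + (j + 1) = N * (1 + j / N) := by
      have := Nat.div_add_mod j N
      rw [mul_add]
      omega
    rw [modVec_mulVec, ← hx, ← modVec_mulVec, Matrix.mulVec_mulVec, ← pow_add, hexp,
      modVec_mulVec, modMatrix_pow, pow_mul, hPN, one_pow, Matrix.one_mulVec])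
  refine ⟨j % N, e', he', ?_⟩
  rw [← h, Matrix.mulVec_smul, Matrix.mulVec_mulVec, ← pow_add, Matrix.smul_mulVec,
    Nat.add_sub_cancel' hj]

/-- Reduction bounds orthogonal sets by cliques; conversely a clique is lifted to `ℤⁿ`, corrected by
the map of `exists_map_mem_orbit`, and extended to a maximal orthogonal set. -/
lemma maxOrthogonalCard_eq [Fact p.Prime]
    (hμ : ∀ ξ, fourier μ ξ = 0 ↔ ∃ x ∈ orbit P C E, Q • ξ = toReal x) (hQ : Q ≠ 0)
    (hP : IsUnit (modMatrix p P))
    (hCT : C * T = δ • 1) (hTC : T * C = δ • 1) (hδ : (δ : ZMod p) ≠ 0)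
    (hE : ∀ e e', modVec p e = modVec p e' → e ∈ E → e' ∈ E)
    (h0 : (0 : Fin n → ZMod p) ∉ modVec p '' orbit P C E) :
    maxOrthogonalCard μ = cliqueNum (modVec p '' orbit P C E) := by
  refine le_antisymm (iSup₂_le fun Λ hΛ => hΛ.2.prop.encard_le_cliqueNum hμ h0)
    (iSup₂_le fun K hK => ?_)
  obtain ⟨A, hA⟩ := exists_map_mem_orbit hP hCT hTC hδ hE
  obtain ⟨g, hg⟩ := (modVec_surjective (n := n) p).hasRightInverse
  have hdiff : ∀ a ∈ K, ∀ b ∈ K, a ≠ b → A.mulVec (g b) - A.mulVec (g a) ∈ orbit P C E := by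
    intro a ha b hb hab
    rw [← Matrix.mulVec_sub]
    apply hA
    rw [modVec_sub, hg, hg]
    exact hK ha hb hab
  have hinj : Set.InjOn (fun a => A.mulVec (g a)) K := by
    intro a ha b hb hab
    by_contra hne
    have := hdiff a ha b hb hne
    simp only at hab
    rw [hab, sub_self] at this
    exact zero_notMem_orbit hμ this
  have horth := orthogonalExps_image hμ hQ (X := (fun a => A.mulVec (g a)) '' K) (by
    rintro _ ⟨a, ha, rfl⟩ _ ⟨b, hb, rfl⟩ hab
    exact hdiff a ha b hb fun h => hab (h ▸ rfl))
  obtain ⟨Λ, hsub, hmax⟩ := exists_maximal_orthogonalExps μ horth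
  -- The supremum runs only over countable maximal sets; the clique bound in the finite group `(ZMod
  -- p)ⁿ` makes this one finite.
  have hfin : Λ.Finite := by
    rw [← Set.encard_lt_top_iff]
    refine ((hmax.prop.encard_le_cliqueNum hμ h0).trans (cliqueNum_le_card _)).trans_lt ?_
    simp
  refine le_iSup₂_of_le Λ ⟨hfin.countable, hmax⟩ ?_
  rw [← hinj.encard_image, ← (injective_inv_smul_toReal hQ).encard_image]
  exact Set.encard_le_encard hsub

end model

/-! ### Mask zeros on the grid `p⁻¹ ℤⁿ` and the resulting orbits -/

/-- The integer vectors `e` for which `e / p` is a zero of the mask polynomial. -/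
def gridZeros (p : ℕ) (D : Finset (Fin n → ℤ)) : Set (Fin n → ℤ) :=
  {e | maskPoly D ((p : ℝ)⁻¹ • toReal e) = 0}

lemma gridZeros_congr {p : ℕ} (hp : p ≠ 0) (D : Finset (Fin n → ℤ)) (e e' : Fin n → ℤ)
    (h : modVec p e = modVec p e') (he : e ∈ gridZeros p D) : e' ∈ gridZeros p D := by
  have : ∀ i, ∃ y : ℤ, e' i = e i + p * y := fun i => by
    obtain ⟨y, hy⟩ := (ZMod.intCast_eq_intCast_iff_dvd_sub _ _ _).1 (congrFun h i)
    exact ⟨y, by rw [← hy]; ring⟩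
  choose y hy using this
  have hp' : (p : ℝ) ≠ 0 := by exact_mod_cast hp
  have : (p : ℝ)⁻¹ • toReal e' = (p : ℝ)⁻¹ • toReal e + toReal y := by
    ext i
    simp only [toReal, hy, Pi.add_apply, Pi.smul_apply, smul_eq_mul]
    push_cast
    field_simp
  rw [gridZeros, Set.mem_ofPred_eq, this, maskPoly_add_toReal]
  exact he

lemma neg_mem_gridZeros {p : ℕ} {D : Finset (Fin n → ℤ)} (e : Fin n → ℤ)
    (he : e ∈ gridZeros p D) : -e ∈ gridZeros p D := by
  have : (p : ℝ)⁻¹ • toReal (-e) = -((p : ℝ)⁻¹ • toReal e) := by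
    ext i; simp [toReal]
  rw [gridZeros, Set.mem_ofPred_eq, this, maskPoly_neg, show maskPoly D _ = 0 from he, map_zero]

/-- If the zeros in the unit cube lie on the punctured grid, then all zeros lie in
`p⁻¹ ℤⁿ`. -/
lemma exists_smul_eq_toReal {p : ℕ} (hp : p ≠ 0) {D : Finset (Fin n → ℤ)}
    (hZ : maskZeros D ⊆ puncturedGrid n p) {x : Fin n → ℝ} (hx : maskPoly D x = 0) :
    ∃ e : Fin n → ℤ, (p : ℝ) • x = toReal e := by
  have hp' : (p : ℝ) ≠ 0 := by exact_mod_cast hp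
  -- Periodicity moves any zero into the unit cube, where the hypothesis applies.
  have hfr : x = (fun i => Int.fract (x i)) + toReal fun i => ⌊x i⌋ := by
    ext i
    exact (Int.fract_add_floor (x i)).symm
  rw [hfr, maskPoly_add_toReal] at hx
  obtain ⟨-, l, -, hl⟩ := hZ ⟨hx, fun i => ⟨Int.fract_nonneg _, Int.fract_lt_one _⟩⟩
  refine ⟨fun i => l i + p * ⌊x i⌋, ?_⟩
  ext i
  have h1 : Int.fract (x i) = l i / p := hl i
  simp only [toReal, Pi.smul_apply, smul_eq_mul]
  push_cast
  rw [← Int.self_sub_floor, sub_eq_iff_eq_add] at h1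
  conv_lhs => rw [h1]
  field_simp

/-- A zero `z` of the mask of `A D` has `p Aᵀ z = e` with `e` an integer vector; multiplying by the
transposed adjugate instead of inverting `Aᵀ` gives `p (det A) z = (adj A)ᵀ e`, which is integral.
-/
lemma fourier_image_eq_zero_iff {p : ℕ} (hp : p ≠ 0) {M A : Matrix (Fin n) (Fin n) ℤ}
    (hM : IsExpanding M) (hA : A.det ≠ 0) {D : Finset (Fin n → ℤ)}
    (hZ : ∀ x, maskPoly D x = 0 → ∃ e : Fin n → ℤ, (p : ℝ) • x = toReal e)
    {μ : Measure (Fin n → ℝ)} (hμ : IsSelfAffineMeasure M (D.image A.mulVec) μ)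
    (ξ : Fin n → ℝ) :
    fourier μ ξ = 0 ↔ ∃ x ∈ orbit M.transpose A.adjugate.transpose (gridZeros p D),
      ((p : ℝ) * (A.det : ℝ)) • ξ = toReal x := by
  have hp' : (p : ℝ) ≠ 0 := by exact_mod_cast hp
  have hA' : (A.det : ℝ) ≠ 0 := by exact_mod_cast hA
  have hpow : ∀ (j : ℕ) (v : Fin n → ℤ), toReal ((M.transpose ^ j).mulVec v) =
      ((M.map (fun a : ℤ => (a : ℝ))).transpose ^ j).mulVec (toReal v) := by
    intro j v
    rw [toReal_mulVec]
    congr 1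
    exact (Int.castRingHom ℝ).mapMatrix.map_pow M.transpose j
  have hsm : ∀ N : Matrix (Fin n) (Fin n) ℤ, N = A.det • 1 → N.map (fun a : ℤ => (a : ℝ)) =
      (A.det : ℝ) • 1 := by
    rintro _ rfl
    ext i j
    simp only [Matrix.map_apply, Matrix.smul_apply, Matrix.one_apply]
    split_ifs <;> simp
  have hmul : ∀ N K : Matrix (Fin n) (Fin n) ℤ, (N * K).map (fun a : ℤ => (a : ℝ)) =
      N.map (fun a : ℤ => (a : ℝ)) * K.map (fun a : ℤ => (a : ℝ)) :=
    (Int.castRingHom ℝ).mapMatrix.map_mul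
  have hCA := hsm (A.adjugate.transpose * A.transpose) (by
    rw [← Matrix.transpose_mul, Matrix.mul_adjugate, Matrix.transpose_smul, Matrix.transpose_one])
  have hAC := hsm (A.transpose * A.adjugate.transpose) (by
    rw [← Matrix.transpose_mul, Matrix.adjugate_mul, Matrix.transpose_smul, Matrix.transpose_one])
  rw [hmul, Matrix.transpose_map, Matrix.transpose_map] at hCA hAC
  rw [fourier_eq_zero_iff_exists hM hμ]
  simp only [maskPoly_image hA]
  constructor
  · rintro ⟨j, z, hz, rfl⟩
    obtain ⟨e, he⟩ := hZ _ hz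
    refine ⟨_, ⟨j, e, ?_, rfl⟩, ?_⟩
    · rw [gridZeros, Set.mem_ofPred_eq, ← he, inv_smul_smul₀ hp']
      exact hz
    · rw [hpow, toReal_mulVec, ← he, ← Matrix.mulVec_smul]
      congr 1
      rw [Matrix.mulVec_smul, Matrix.transpose_map, Matrix.mulVec_mulVec,
        hCA, Matrix.smul_mulVec, Matrix.one_mulVec, smul_smul]
  · rintro ⟨_, ⟨j, e, he, rfl⟩, hx⟩
    refine ⟨j, ((p : ℝ) * (A.det : ℝ))⁻¹ • toReal (A.adjugate.transpose.mulVec e), ?_, ?_⟩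
    · rw [Matrix.mulVec_smul, toReal_mulVec, Matrix.transpose_map, Matrix.mulVec_mulVec,
        hAC, Matrix.smul_mulVec, Matrix.one_mulVec, smul_smul, mul_inv,
        mul_assoc, inv_mul_cancel₀ hA', mul_one]
      exact he
    · rw [Matrix.mulVec_smul, ← hpow, ← hx, inv_smul_smul₀ (mul_ne_zero hp' hA')]

/-! ### Comparison of the two reduced orbits -/

section compare

variable {p : ℕ} [Fact p.Prime] {M M' A B : Matrix (Fin n) (Fin n) ℤ} {D : Finset (Fin n → ℤ)}

/-- Mod `p` the adjugate of `A` is `det A • B`, and `Bᵀ` intertwines `Mᵀ` with `M'ᵀ`. Only a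
congruence for `M'` is assumed, so the roles of the two pairs can be exchanged. -/
lemma modVec_image_orbit (hAB : modMatrix p (A * B) = 1)
    (hM' : modMatrix p M' = modMatrix p A * modMatrix p M * modMatrix p B)
    (E : Set (Fin n → ℤ)) :
    modVec p '' orbit M'.transpose A.adjugate.transpose E =
      ((A.det : ZMod p) • (modMatrix p B).transpose).mulVec ''
        (modVec p '' orbit M.transpose 1 E) := by
  rw [modMatrix_mul] at hAB
  have hBA := mul_eq_one_comm.1 hAB
  have hadj : modMatrix p A.adjugate = (A.det : ZMod p) • modMatrix p B := by
    calc modMatrix p A.adjugate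
        = modMatrix p (A.adjugate * A) * modMatrix p B := by
          rw [modMatrix_mul, mul_assoc, hAB, mul_one]
      _ = _ := by
          rw [Matrix.adjugate_mul, modMatrix_smul_one, Matrix.smul_mul, one_mul]
  have hsemi : SemiconjBy (modMatrix p B).transpose (modMatrix p M).transpose
      (modMatrix p M').transpose := by
    rw [SemiconjBy, hM', ← Matrix.transpose_mul, ← Matrix.transpose_mul, ← mul_assoc, ← mul_assoc,
      hBA, one_mul]
  have key : ∀ (j : ℕ) (e : Fin n → ℤ),
      modVec p ((M'.transpose ^ (j + 1)).mulVec (A.adjugate.transpose.mulVec e)) =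
      ((A.det : ZMod p) • (modMatrix p B).transpose).mulVec
        (modVec p ((M.transpose ^ (j + 1)).mulVec ((1 : Matrix (Fin n) (Fin n) ℤ).mulVec e))) := by
    intro j e
    rw [Matrix.one_mulVec, modVec_mulVec, modVec_mulVec, modVec_mulVec, modMatrix_pow,
      modMatrix_pow, modMatrix_transpose, modMatrix_transpose, modMatrix_transpose, hadj,
      Matrix.transpose_smul, Matrix.mulVec_mulVec, Matrix.mulVec_mulVec, Matrix.mul_smul,
      Matrix.smul_mul, (hsemi.pow_right (j + 1)).eq]
  ext v
  constructor
  · rintro ⟨_, ⟨j, e, he, rfl⟩, rfl⟩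
    exact ⟨_, ⟨_, ⟨j, e, he, rfl⟩, rfl⟩, (key j e).symm⟩
  · rintro ⟨_, ⟨_, ⟨j, e, he, rfl⟩, rfl⟩, rfl⟩
    exact ⟨_, ⟨j, e, he, rfl⟩, key j e⟩

lemma cliqueNum_image_mulVec {F : Type*} [Field F] {N : Matrix (Fin n) (Fin n) F}
    (hN : IsUnit N) (S : Set (Fin n → F)) : cliqueNum (N.mulVec '' S) = cliqueNum S := by
  obtain ⟨u, rfl⟩ := hN
  refine le_antisymm
    (cliqueNum_le_of_map (↑u⁻¹ : Matrix (Fin n) (Fin n) F).mulVec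
      (Matrix.mulVec_injective_of_isUnit u⁻¹.isUnit) (Matrix.mulVec_sub _) ?_)
    (cliqueNum_le_of_map (↑u : Matrix (Fin n) (Fin n) F).mulVec
      (Matrix.mulVec_injective_of_isUnit u.isUnit) (Matrix.mulVec_sub _)
      fun s hs => ⟨s, hs, rfl⟩)
  rintro _ ⟨s, hs, rfl⟩
  rwa [Matrix.mulVec_mulVec, Units.inv_mul, Matrix.one_mulVec]

/-- Comparison of the self-affine measures of two pairs whose matrices are conjugate modulo `p`
and whose digit sets correspond under the conjugation. -/
theorem orthogonalExps_comparison (hM : IsExpanding M) (hM' : IsExpanding M') (hD : D.Nonempty)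
    (hAB : modMatrix p (A * B) = 1)
    (hconj : modMatrix p M' = modMatrix p A * modMatrix p M * modMatrix p B)
    (hZ : ∀ x, maskPoly D x = 0 → ∃ e : Fin n → ℤ, (p : ℝ) • x = toReal e)
    {μ μ' : Measure (Fin n → ℝ)} [IsProbabilityMeasure μ] [IsProbabilityMeasure μ']
    (hμ : IsSelfAffineMeasure M D μ) (hμ' : IsSelfAffineMeasure M' (D.image A.mulVec) μ') :
    (HasInfiniteOrthogonalExps μ ↔ HasInfiniteOrthogonalExps μ') ∧
    (¬ (p : ℤ) ∣ M.det → maxOrthogonalCard μ = maxOrthogonalCard μ' ∧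
      maxOrthogonalCard μ' ≤ ((p ^ n : ℕ) : ℕ∞)) := by
  have hp : p ≠ 0 := (Fact.out : p.Prime).ne_zero
  have hp' : (p : ℝ) ≠ 0 := by exact_mod_cast hp
  have hdetAB : (A.det : ZMod p) * (B.det : ZMod p) = 1 := by
    rw [← det_modMatrix, ← det_modMatrix, ← Matrix.det_mul, ← modMatrix_mul, hAB, Matrix.det_one]
  have hδ : (A.det : ZMod p) ≠ 0 := left_ne_zero_of_mul_eq_one hdetAB
  have hA : A.det ≠ 0 := fun h => hδ (by rw [h, Int.cast_zero])
  have hA' : (A.det : ℝ) ≠ 0 := by exact_mod_cast hA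
  have hzero : ∀ ξ, fourier μ ξ = 0 ↔
      ∃ x ∈ orbit M.transpose 1 (gridZeros p D), (p : ℝ) • ξ = toReal x := by
    have himg : D.image (1 : Matrix (Fin n) (Fin n) ℤ).mulVec = D := by
      simp [funext fun v => Matrix.one_mulVec (α := ℤ) (m := Fin n) v]
    -- The unprimed measure is the case `A = 1`, with scale `p`.
    have := fourier_image_eq_zero_iff (A := 1) hp hM (by simp) hZ (himg.symm ▸ hμ)
    simpa using this
  have hzero' := fourier_image_eq_zero_iff hp hM' hA hZ hμ'
  have hE := gridZeros_congr hp D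
  have hneg := neg_mem_gridZeros (p := p) (D := D)
  have hone : (1 : Matrix (Fin n) (Fin n) ℤ) * 1 = (1 : ℤ) • 1 := by simp
  have hCA : A.adjugate.transpose * A.transpose = A.det • 1 := by
    rw [← Matrix.transpose_mul, Matrix.mul_adjugate, Matrix.transpose_smul, Matrix.transpose_one]
  have hAC : A.transpose * A.adjugate.transpose = A.det • 1 := by
    rw [← Matrix.transpose_mul, Matrix.adjugate_mul, Matrix.transpose_smul, Matrix.transpose_one]
  have hδ1 : ((1 : ℤ) : ZMod p) ≠ 0 := by simp
  have hQ' := mul_ne_zero hp' hA'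
  have hS := modVec_image_orbit hAB hconj (gridZeros p D)
  have hunit : IsUnit ((A.det : ZMod p) • (modMatrix p B).transpose) := by
    rw [Matrix.isUnit_iff_isUnit_det, Matrix.det_smul, Matrix.det_transpose, det_modMatrix,
      isUnit_iff_ne_zero]
    exact mul_ne_zero (pow_ne_zero _ hδ) (right_ne_zero_of_mul_eq_one hdetAB)
  have hzero_iff : (0 : Fin n → ZMod p) ∈
        modVec p '' orbit M'.transpose A.adjugate.transpose (gridZeros p D) ↔
      (0 : Fin n → ZMod p) ∈ modVec p '' orbit M.transpose 1 (gridZeros p D) := by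
    rw [hS]
    conv_lhs => rw [← Matrix.mulVec_zero ((A.det : ZMod p) • (modMatrix p B).transpose)]
    exact (Matrix.mulVec_injective_of_isUnit hunit).mem_set_image
  refine ⟨?_, fun hdet => ?_⟩
  · rw [hasInfiniteOrthogonalExps_iff hzero hp' hone hone hδ1 hE hneg,
      hasInfiniteOrthogonalExps_iff hzero' hQ' hCA hAC hδ hE hneg, hzero_iff]
  · have hdet : (M.det : ZMod p) ≠ 0 := by rwa [Ne, ZMod.intCast_zmod_eq_zero_iff_dvd]
    have hP : IsUnit (modMatrix p M.transpose) := by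
      rwa [Matrix.isUnit_iff_isUnit_det, det_modMatrix, isUnit_iff_ne_zero, Matrix.det_transpose]
    have hP' : IsUnit (modMatrix p M'.transpose) := by
      rw [Matrix.isUnit_iff_isUnit_det, modMatrix_transpose, Matrix.det_transpose, hconj,
        Matrix.det_mul, Matrix.det_mul, det_modMatrix, det_modMatrix, det_modMatrix,
        isUnit_iff_ne_zero]
      exact mul_ne_zero (mul_ne_zero hδ hdet) (right_ne_zero_of_mul_eq_one hdetAB)
    -- As `Mᵀ` is invertible mod `p`, a vanishing orbit element would force `e ≡ 0`, hence `0 ∈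
    -- gridZeros p D`, contradicting `m_D(0) = 1`.
    have h0 : (0 : Fin n → ZMod p) ∉ modVec p '' orbit M.transpose 1 (gridZeros p D) := by
      rintro ⟨_, ⟨j, e, he, rfl⟩, h⟩
      rw [Matrix.one_mulVec, modVec_mulVec, modMatrix_pow,
        ← Matrix.mulVec_zero (modMatrix p M.transpose ^ (j + 1))] at h
      have h1 := Matrix.mulVec_injective_of_isUnit (hP.pow _) h
      have h2 := hE e 0 (by rw [h1]; ext i; simp [modVec]) he
      have h3 : (p : ℝ)⁻¹ • toReal (0 : Fin n → ℤ) = 0 := by ext i; simp [toReal]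
      rw [gridZeros, Set.mem_ofPred_eq, h3, maskPoly_zero hD] at h2
      exact one_ne_zero h2
    rw [maxOrthogonalCard_eq hzero hp' hP hone hone hδ1 hE h0,
      maxOrthogonalCard_eq hzero' hQ' hP' hCA hAC hδ hE (hzero_iff.not.2 h0), hS,
      cliqueNum_image_mulVec hunit]
    refine ⟨rfl, (cliqueNum_le_card _).trans ?_⟩
    rw [ENat.card_eq_coe_fintype_card, Fintype.card_fun, ZMod.card, Fintype.card_fin]

end compare

/-- The zeros of the mask polynomial lie in `p⁻¹ ℤⁿ` if this holds for the image of the digit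
set under an integer matrix that is invertible modulo `p`. -/
lemma exists_smul_eq_toReal_of_image {p : ℕ} {A : Matrix (Fin n) (Fin n) ℤ} (hA : A.det ≠ 0)
    {D : Finset (Fin n → ℤ)}
    (hZ : ∀ x, maskPoly (D.image A.mulVec) x = 0 → ∃ e : Fin n → ℤ, (p : ℝ) • x = toReal e)
    {x : Fin n → ℝ} (hx : maskPoly D x = 0) : ∃ e : Fin n → ℤ, (p : ℝ) • x = toReal e := by
  have hu : IsUnit (A.map (fun a : ℤ => (a : ℝ))).transpose.det := by
    have : (A.map (fun a : ℤ => (a : ℝ))).det = (A.det : ℝ) :=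
      (RingHom.map_det (Int.castRingHom ℝ) A).symm
    rw [Matrix.det_transpose, this, isUnit_iff_ne_zero]
    exact_mod_cast hA
  have hz : (A.map (fun a : ℤ => (a : ℝ))).transpose.mulVec
      ((A.map (fun a : ℤ => (a : ℝ))).transpose⁻¹.mulVec x) = x := by
    rw [Matrix.mulVec_mulVec, Matrix.mul_nonsing_inv _ hu, Matrix.one_mulVec]
  obtain ⟨e, he⟩ := hZ _ (by rw [maskPoly_image hA, hz]; exact hx)
  refine ⟨A.transpose.mulVec e, ?_⟩
  rw [toReal_mulVec, ← he, Matrix.mulVec_smul, Matrix.transpose_map, hz]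

end SelfAffine

/-! ### The two directions of the digit correspondence -/

theorem theorem1p5 (n p : ℕ) (hp : p.Prime)
    (M M' : Matrix (Fin n) (Fin n) ℤ) (D D' : Finset (Fin n → ℤ))
    (hM : SelfAffine.IsExpanding M) (hM' : SelfAffine.IsExpanding M')
    (hD : D.Nonempty) (hD' : D'.Nonempty)
    (hconj : SelfAffine.ConjugateInGL p M D M' D')
    (hZ : SelfAffine.maskZeros D' ⊆ SelfAffine.puncturedGrid n p ∨
      SelfAffine.maskZeros D ⊆ SelfAffine.puncturedGrid n p) :
    (SelfAffine.HasInfiniteOrthogonalExps (SelfAffine.selfAffineMeasure M D hM hD) ↔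
      SelfAffine.HasInfiniteOrthogonalExps (SelfAffine.selfAffineMeasure M' D' hM' hD')) ∧
    (¬ (p : ℤ) ∣ M.det →
      SelfAffine.maxOrthogonalCard (SelfAffine.selfAffineMeasure M D hM hD) =
        SelfAffine.maxOrthogonalCard (SelfAffine.selfAffineMeasure M' D' hM' hD') ∧
      SelfAffine.maxOrthogonalCard (SelfAffine.selfAffineMeasure M' D' hM' hD') ≤
        ((p ^ n : ℕ) : ℕ∞)) := by
  have : Fact p.Prime := ⟨hp⟩
  have hp0 := hp.ne_zero
  obtain ⟨A, B, -, -, hAB, rfl, hDD⟩ := hconj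
  have hAB' := hAB
  rw [SelfAffine.modMatrix_mul] at hAB'
  have hBA' := mul_eq_one_comm.1 hAB'
  have hBA : SelfAffine.modMatrix p (B * A) = 1 := by rw [SelfAffine.modMatrix_mul, hBA']
  have hAB0 : A.det ≠ 0 ∧ B.det ≠ 0 := by
    have h := congrArg Matrix.det hAB'
    rw [Matrix.det_mul, SelfAffine.det_modMatrix, SelfAffine.det_modMatrix, Matrix.det_one] at h
    exact ⟨fun h0 => by simp [h0] at h, fun h0 => by simp [h0] at h⟩
  have hconj : SelfAffine.modMatrix p (A * M * B) =
      SelfAffine.modMatrix p A * SelfAffine.modMatrix p M * SelfAffine.modMatrix p B := by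
    rw [SelfAffine.modMatrix_mul, SelfAffine.modMatrix_mul]
  rcases hDD with rfl | rfl
  -- When `D = B D'` the comparison runs from `(M', D')` to `(M, D)` with `A` and `B` exchanged; `M
  -- = B M' A` then holds mod `p`, which suffices.
  · have hconj' : SelfAffine.modMatrix p M = SelfAffine.modMatrix p B *
        SelfAffine.modMatrix p (A * M * B) * SelfAffine.modMatrix p A := by
      rw [hconj, mul_assoc, mul_assoc, mul_assoc, hBA', mul_one, ← mul_assoc, hBA', one_mul]
    obtain ⟨hinf, hcard⟩ := SelfAffine.orthogonalExps_comparison hM' hM hD' hBA hconj'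
      (fun x hx => hZ.elim (fun h => SelfAffine.exists_smul_eq_toReal hp0 h hx) fun h =>
        SelfAffine.exists_smul_eq_toReal_of_image hAB0.2
          (fun _ => SelfAffine.exists_smul_eq_toReal hp0 h) hx)
      (SelfAffine.selfAffineMeasure_spec _ _ hM' hD') (SelfAffine.selfAffineMeasure_spec _ _ hM hD)
    refine ⟨hinf.symm, fun hdet => ?_⟩
    obtain ⟨heq, hle⟩ := hcard (by
      rw [← ZMod.intCast_zmod_eq_zero_iff_dvd] at hdet ⊢
      rw [Matrix.det_mul, Matrix.det_mul, Int.cast_mul, Int.cast_mul]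
      have h := congrArg Matrix.det hAB'
      rw [Matrix.det_mul, SelfAffine.det_modMatrix, SelfAffine.det_modMatrix,
        Matrix.det_one] at h
      exact mul_ne_zero (mul_ne_zero (left_ne_zero_of_mul_eq_one h) hdet)
        (right_ne_zero_of_mul_eq_one h))
    exact ⟨heq.symm, heq.le.trans hle⟩
  · exact SelfAffine.orthogonalExps_comparison hM hM' hD hAB hconj
      (fun x hx => hZ.elim (fun h => SelfAffine.exists_smul_eq_toReal_of_image hAB0.1
          (fun _ => SelfAffine.exists_smul_eq_toReal hp0 h) hx) fun h =>
        SelfAffine.exists_smul_eq_toReal hp0 h hx)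
      (SelfAffine.selfAffineMeasure_spec _ _ hM hD) (SelfAffine.selfAffineMeasure_spec _ _ hM' hD')
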